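/- There is an absolute constant $c>0$ such that every finite connected vertex transitive digraph $D$ on $n\ge 2$ vertices contains a directed cycle of length at least $c\,n^{1/3}$. Here $D$ is connected if its underlying undirected graph is connected, and vertex transitive if for any two vertices $u,v$ some automorphism of $D$ maps $u$ to $v$. A directed cycle is a cyclic sequence of at least two distinct vertices with an arc from each vertex to the next, and its length is the number of its vertices. -/

import Mathlib

/-- A digraph is connected if its underlying undirected graph, obtained by forgetting the
directions of the arcs, is connected. -/
def Digraph.IsConnected {V : Type*} (D : Digraph V) : Prop :=
  D.toSimpleGraphInclusive.Connected

/-- A digraph is vertex transitive if for any two vertices `u`, `v` some automorphism of the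
digraph (a permutation of the vertices preserving arcs and non-arcs) maps `u` to `v`. -/
def Digraph.IsVertexTransitive {V : Type*} (D : Digraph V) : Prop :=
  ∀ u v : V, ∃ φ : D.Adj ≃r D.Adj, φ u = v

/-- A directed cycle of a digraph: a cyclic sequence of at least two pairwise distinct vertices
in which there is an arc from each vertex to the cyclically next one. Two opposite arcs form a
directed cycle of length two; a loop is not regarded as a directed cycle. The length of the
directed cycle (its number of arcs) is `C.length`. -/
def Digraph.IsDirectedCycle {V : Type*} (D : Digraph V) (C : Cycle V) : Prop :=
  2 ≤ C.length ∧ C.Nodup ∧ C.Chain D.Adj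

open Relation

/-! Suppose every directed cycle has fewer than `t` vertices; then `n ≤ 832 * t ^ 3`. If deleting
any path on at most `t` vertices left a strong component on more than half of the vertices, a path
chasing these components would close into a cycle of length at least `t`
(`exists_cycle_of_bigClass_nonempty`). So some such path `l` leaves none, and `bigClass_nonempty`
gives a set `A` with `|A|, |Aᶜ| ≥ n/4` whose outgoing arcs all end in `l`. Each arc lies on a cycle
shorter than `t`, so every edge between `A` and `Aᶜ` is within `O(t)` of `l`. In a vertex transitive
graph a cut inside a ball has one side inside the doubled ball (`CutNear.forall_dist_le`). Hence a
ball of radius `O(t)` holds a quarter of the vertices, the undirected diameter is `O(t)` and the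
directed one `O(t²)`. Isoperimetry (`card_mul_card_compl_le`) then gives `n²/16 ≤ n * O(t²) * t`. -/

theorem Relation.ReflTransGen.exists_nodup_isChain {α : Type*} {r : α → α → Prop} {a b : α}
    (h : ReflTransGen r a b) :
    ∃ L : List α, L.Nodup ∧ L.IsChain r ∧ L.head? = some a ∧ L.getLast? = some b ∧
      ∀ x ∈ L, ReflTransGen r a x := by
  induction h using ReflTransGen.head_induction_on with
  | refl => exact ⟨[b], by simp, by simp, by simp, by simp, by simp [ReflTransGen.refl]⟩
  | @head a c hac hcb ih =>
    obtain ⟨L, hnd, hch, hhd, hlast, hreach⟩ := ih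
    by_cases ha : a ∈ L
    -- A repeated vertex is removed by keeping only the part of the path from its earlier
    -- occurrence.
    · obtain ⟨s, u, rfl⟩ := List.append_of_mem ha
      refine ⟨a :: u, hnd.of_append_right, hch.right_of_append, by simp, ?_, ?_⟩
      · rw [← hlast, List.getLast?_append_of_ne_nil _ (by simp)]
      · intro x hx
        exact .head hac (hreach x (List.mem_append_right _ hx))
    · refine ⟨a :: L, List.nodup_cons.2 ⟨ha, hnd⟩, hch.cons ?_, by simp, ?_, ?_⟩
      · intro y hy
        rw [hhd] at hy
        simp only [Option.mem_def, Option.some.injEq] at hy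
        exact hy ▸ hac
      · cases L with
        | nil => simp at hhd
        | cons d L => simpa [List.getLast?_cons] using hlast
      · intro x hx
        rcases List.mem_cons.1 hx with rfl | hx
        · exact .refl
        · exact .head hac (hreach x hx)

/-! ### Strong components after deletion of a vertex set -/

section BigClass

variable {V : Type*} (r : V → V → Prop)

/-- `AvoidReach r Z v w` says that `w` can be reached from `v` along `r` outside `Z`. -/
def AvoidReach (Z : Set V) : V → V → Prop :=
  ReflTransGen fun a b ↦ r a b ∧ a ∉ Z ∧ b ∉ Z

/-- The strong component of `v` after deletion of `Z`. -/
def strongClass (Z : Set V) (v : V) : Set V :=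
  {w | AvoidReach r Z v w ∧ AvoidReach r Z w v}

/-- The vertices whose strong component after deletion of `Z` contains more than half of all
vertices. -/
def bigClass (Z : Set V) : Set V :=
  {v | Nat.card V < 2 * (strongClass r Z v).ncard}

variable {r} {Z Z' : Set V} {v w x : V}

theorem AvoidReach.mono (hZ : Z ⊆ Z') (h : AvoidReach r Z' v w) : AvoidReach r Z v w :=
  ReflTransGen.mono (fun _ _ h ↦ ⟨h.1, fun h' ↦ h.2.1 (hZ h'), fun h' ↦ h.2.2 (hZ h')⟩) _ _ h

theorem AvoidReach.notMem (h : AvoidReach r Z v w) (hv : v ∉ Z) : w ∉ Z := by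
  induction h with
  | refl => exact hv
  | tail _ h _ => exact h.2.2

theorem AvoidReach.eq_of_mem (h : AvoidReach r Z v w) (hv : v ∈ Z) : w = v := by
  induction h using ReflTransGen.head_induction_on with
  | refl => rfl
  | head h _ _ => exact absurd hv h.2.1

theorem strongClass_mono (hZ : Z ⊆ Z') : strongClass r Z' v ⊆ strongClass r Z v :=
  fun _ h ↦ ⟨h.1.mono hZ, h.2.mono hZ⟩

theorem strongClass_eq (h : w ∈ strongClass r Z v) : strongClass r Z w = strongClass r Z v :=
  Set.ext fun _ ↦ ⟨fun hx ↦ ⟨h.1.trans hx.1, hx.2.trans h.2⟩,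
    fun hx ↦ ⟨h.2.trans hx.1, hx.2.trans h.1⟩⟩

/-- A walk between two vertices of a strong component stays in it. -/
theorem AvoidReach.of_disjoint (h : AvoidReach r Z w x) (hw : AvoidReach r Z v w)
    (hx : AvoidReach r Z x v) (hd : ∀ y ∈ strongClass r Z v, y ∉ Z') : AvoidReach r Z' w x := by
  induction h using ReflTransGen.head_induction_on with
  | refl => exact .refl
  | @head a c hac hcb ih =>
    have hc : AvoidReach r Z v c := hw.tail hac
    exact .head ⟨hac.1, hd _ ⟨hw, .head hac (hcb.trans hx)⟩, hd _ ⟨hc, hcb.trans hx⟩⟩ (ih hc)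

theorem strongClass_subset_bigClass (hv : v ∈ bigClass r Z) :
    strongClass r Z v ⊆ bigClass r Z := fun w hw ↦ by
  rw [bigClass, Set.mem_ofPred_eq, strongClass_eq hw]; exact hv

theorem avoidReach_closed {a b : V} (ha : AvoidReach r Z v a) (hv : v ∉ Z) (hab : r a b) :
    AvoidReach r Z v b ∨ b ∈ Z := by
  by_cases hb : b ∈ Z
  · exact .inr hb
  · exact .inl (ha.tail ⟨hab, ha.notMem hv, hb⟩)

variable [Finite V]

theorem bigClass_anti (hZ : Z ⊆ Z') : bigClass r Z' ⊆ bigClass r Z := fun v hv ↦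
  lt_of_lt_of_le hv (Nat.mul_le_mul_left 2 (Set.ncard_le_ncard (strongClass_mono hZ)))

theorem mem_strongClass_of_mem_bigClass (hv : v ∈ bigClass r Z) (hw : w ∈ bigClass r Z) :
    w ∈ strongClass r Z v := by
  have h : ¬ Disjoint (strongClass r Z v) (strongClass r Z w) := fun hd ↦ by
    have h1 := Set.ncard_union_eq hd
    have h2 := Set.ncard_le_card (strongClass r Z v ∪ strongClass r Z w)
    have h3 : Nat.card V < 2 * _ := hv
    have h4 : Nat.card V < 2 * _ := hw
    omega
  obtain ⟨x, hx, hx'⟩ := Set.not_disjoint_iff.1 h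
  exact ⟨hx.1.trans hx'.2, hx'.1.trans hx.2⟩

/-- Deleted vertices stay in `V` and reach themselves by the empty walk, so they form singleton
classes; these exceed half only when there is a single vertex. -/
theorem notMem_of_mem_bigClass (hn : 2 ≤ Nat.card V) (hv : v ∈ bigClass r Z) : v ∉ Z := fun h ↦ by
  have h1 : strongClass r Z v ⊆ {v} := fun w hw ↦ hw.1.eq_of_mem h
  have h2 := Set.ncard_le_ncard h1
  have h3 : Nat.card V < 2 * _ := hv
  rw [Set.ncard_singleton] at h2
  omega

/-- Walks joining two vertices of a strong component never leave it, so deletions elsewhere do not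
affect it. -/
theorem bigClass_eq_of_disjoint (hZ : Z ⊆ Z') (hd : ∀ y ∈ bigClass r Z, y ∉ Z') :
    bigClass r Z = bigClass r Z' := by
  refine Set.Subset.antisymm (fun v hv ↦ ?_) (bigClass_anti hZ)
  refine lt_of_lt_of_le hv (Nat.mul_le_mul_left 2 (Set.ncard_le_ncard fun w hw ↦ ?_))
  have hd' : ∀ y ∈ strongClass r Z v, y ∉ Z' := fun y hy ↦ hd y (strongClass_subset_bigClass hv hy)
  exact ⟨hw.1.of_disjoint .refl hw.2 hd', hw.2.of_disjoint hw.1 .refl hd'⟩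

/-- Either some subset of the vertices outside `Z`, closed under `r` up to `Z`, is balanced, or
a strong component outside `Z` contains more than half of the vertices. -/
theorem bigClass_nonempty (hZ : 4 * Z.ncard ≤ 3 * Nat.card V) (hn : 0 < Nat.card V)
    (h : ∀ A : Set V, Disjoint A Z → (∀ a ∈ A, ∀ b, r a b → b ∈ A ∨ b ∈ Z) →
      4 * A.ncard < Nat.card V ∨ 4 * Aᶜ.ncard < Nat.card V) : (bigClass r Z).Nonempty := by
  classical
  let O : V → Set V := fun v ↦ {w | AvoidReach r Z v w}
  have hOd : ∀ v, v ∉ Z → Disjoint (O v) Z := fun v hv ↦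
    Set.disjoint_left.2 fun w hw ↦ AvoidReach.notMem hw hv
  -- Closed sets have size below `n/4` or above `3n/4`. Adding one small set to a small union stays
  -- below `n/2`, hence below `n/4`. The same holds for complements of large closed sets.
  have hsmall : ∀ F : Finset V, (∀ v ∈ F, v ∉ Z ∧ 4 * (O v).ncard < Nat.card V) →
      4 * (⋃ v ∈ F, O v).ncard < Nat.card V := by
    intro F
    induction F using Finset.induction_on with
    | empty => intro _; simpa using hn
    | insert a F _ ih =>
      intro hF
      have h1 := ih fun v hv ↦ hF v (Finset.mem_insert_of_mem hv)
      have h2 := (hF a (Finset.mem_insert_self _ _)).2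
      have h3 : (⋃ v ∈ insert a F, O v).ncard ≤ (O a).ncard + (⋃ v ∈ F, O v).ncard := by
        rw [Finset.set_biUnion_insert]
        exact Set.ncard_union_le _ _
      refine (h (⋃ v ∈ insert a F, O v) ?_ ?_).resolve_right fun h4 ↦ ?_
      · simp only [Set.disjoint_iUnion_left]
        exact fun v hv ↦ hOd v (hF v hv).1
      · intro x hx b hb
        simp only [Set.mem_iUnion] at hx ⊢
        obtain ⟨v, hv, hx⟩ := hx
        exact (avoidReach_closed hx (hF v hv).1 hb).imp_left fun hb ↦ ⟨v, hv, hb⟩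
      · have := Set.ncard_add_ncard_compl (⋃ v ∈ insert a F, O v)
        omega
  have hlarge : ∀ F : Finset V, (∀ v ∈ F, v ∉ Z ∧ 4 * (O v)ᶜ.ncard < Nat.card V) →
      4 * (⋃ v ∈ F, (O v)ᶜ).ncard < Nat.card V := by
    intro F
    induction F using Finset.induction_on with
    | empty => intro _; simpa using hn
    | insert a F _ ih =>
      intro hF
      have h1 := ih fun v hv ↦ hF v (Finset.mem_insert_of_mem hv)
      have h2 := (hF a (Finset.mem_insert_self _ _)).2
      have h3 : (⋃ v ∈ insert a F, (O v)ᶜ).ncard ≤ (O a)ᶜ.ncard + (⋃ v ∈ F, (O v)ᶜ).ncard := by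
        rw [Finset.set_biUnion_insert]
        exact Set.ncard_union_le _ _
      have h4 := h (⋃ v ∈ insert a F, (O v)ᶜ)ᶜ ?_ ?_
      · rw [compl_compl] at h4
        refine h4.resolve_left fun h4 ↦ ?_
        have := Set.ncard_add_ncard_compl (⋃ v ∈ insert a F, (O v)ᶜ)
        omega
      · refine (hOd a (hF a (Finset.mem_insert_self _ _)).1).mono_left fun x hx ↦ ?_
        rw [Finset.set_biUnion_insert] at hx
        by_contra hx'
        exact hx (.inl hx')
      · intro x hx b hb
        simp only [Set.compl_iUnion, compl_compl, Set.mem_iInter] at hx ⊢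
        by_cases hbZ : b ∈ Z
        · exact .inr hbZ
        · exact .inl fun v hv ↦
            (avoidReach_closed (hx v hv) (hF v hv).1 hb).resolve_right hbZ
  have := Fintype.ofFinite V
  let S : Finset V := {v | v ∉ Z ∧ 4 * (O v).ncard < Nat.card V}
  let W : Finset V := {v | v ∉ Z ∧ 4 * (O v)ᶜ.ncard < Nat.card V}
  have hS := hsmall S fun v hv ↦ (Finset.mem_filter.1 hv).2
  have hW := hlarge W fun v hv ↦ (Finset.mem_filter.1 hv).2
  have hcov : ∀ v, v ∉ Z → v ∉ ⋃ v ∈ S, O v → v ∈ W := by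
    intro v hvZ hv
    refine Finset.mem_filter.2 ⟨Finset.mem_univ _, hvZ, ?_⟩
    refine (h (O v) (hOd v hvZ) fun a ha b hb ↦ avoidReach_closed ha hvZ hb).resolve_left
      fun hlt ↦ hv ?_
    simp only [Set.mem_iUnion]
    exact ⟨v, Finset.mem_filter.2 ⟨Finset.mem_univ _, hvZ, hlt⟩, ReflTransGen.refl⟩
  have hsize : ∀ A : Set V, A.ncard < Nat.card V → ∃ v, v ∉ A := by
    intro A hA
    by_contra! hall
    rw [Set.eq_univ_of_forall hall, Set.ncard_univ] at hA
    exact lt_irrefl _ hA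
  -- The bound on `Z` makes `W` nonempty, so that vertices outside `T` lie in `O u` and hence
  -- outside `Z`.
  obtain ⟨u, hu⟩ := hsize (Z ∪ ⋃ v ∈ S, O v) (by
    have := Set.ncard_union_le Z (⋃ v ∈ S, O v)
    omega)
  have huW : u ∈ W := hcov u (fun h ↦ hu (.inl h)) (fun h ↦ hu (.inr h))
  set T : Set V := (⋃ v ∈ W, (O v)ᶜ) ∪ ⋃ v ∈ S, O v with hT
  have hTc := Set.ncard_union_le (⋃ v ∈ W, (O v)ᶜ) (⋃ v ∈ S, O v)
  rw [← hT] at hTc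
  have hTO : ∀ x ∉ T, ∀ v ∈ W, x ∈ O v := by
    intro x hx v hv
    by_contra hxv
    refine hx (.inl ?_)
    simp only [Set.mem_iUnion]
    exact ⟨v, hv, hxv⟩
  have hTW : ∀ x ∉ T, x ∈ W := fun x hx ↦ hcov x
    (AvoidReach.notMem (hTO x hx u huW) fun h ↦ hu (.inl h)) fun h ↦ hx (.inr h)
  -- `T` has fewer than `n/2` vertices, and any two vertices outside it reach each other.
  obtain ⟨v, hv⟩ := hsize T (by omega)
  refine ⟨v, ?_⟩
  have hsub : Tᶜ ⊆ strongClass r Z v := fun x hx ↦ ⟨hTO x hx v (hTW v hv), hTO v hv x (hTW x hx)⟩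
  have h1 := Set.ncard_le_ncard hsub
  have h2 := Set.ncard_add_ncard_compl T
  rw [bigClass, Set.mem_ofPred_eq]
  omega

end BigClass

/-! ### A long cycle from persistent large components -/

theorem List.IsChain.avoidReach {V : Type*} {r : V → V → Prop} {Z : Set V} {a b : V}
    {L : List V} (hL : (a :: L).IsChain r) (hZ : ∀ x ∈ a :: L, x ∉ Z) (hb : b ∈ a :: L) :
    AvoidReach r Z a b := by
  induction L generalizing a with
  | nil =>
    rw [List.mem_singleton] at hb
    exact hb ▸ .refl
  | cons c L ih =>
    rw [List.isChain_cons_cons] at hL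
    rcases List.mem_cons.1 hb with rfl | hb
    · exact .refl
    · exact .head ⟨hL.1, hZ _ (by simp), hZ _ (by simp)⟩
        (ih hL.2 (fun x hx ↦ hZ x (List.mem_cons_of_mem _ hx)) hb)

theorem exists_cycle_of_close {V : Type*} {D : Digraph V} {p q b : V} {l w : List V}
    (hl : l ≠ [])
    (hch : (p :: l ++ q :: w).IsChain D.Adj) (hnd : (p :: l ++ q :: w).Nodup)
    (hb : b ∈ q :: w) (hbp : AvoidReach D.Adj {x | x ∈ l} b p) :
    ∃ C : Cycle V, D.IsDirectedCycle C ∧ l.length + 1 ≤ C.length := by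
  have hq : AvoidReach D.Adj {x | x ∈ l} q p := by
    refine (hch.right_of_append.avoidReach (fun x hx hxl ↦ ?_) hb).trans hbp
    exact List.disjoint_of_nodup_append hnd (List.mem_cons_of_mem _ hxl) hx
  have hql : q ∉ l := fun h ↦
    List.disjoint_of_nodup_append hnd (List.mem_cons_of_mem _ h) (by simp)
  -- A simple path from `q` back to `p` outside `l` closes `p :: l`; `hreach` transfers the
  -- avoidance of `l` to each of its vertices.
  obtain ⟨L, hLnd, hLch, hhd, hlast, hreach⟩ := hq.exists_nodup_isChain
  obtain ⟨m, rfl⟩ := List.getLast?_eq_some_iff.1 hlast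
  refine ⟨(p :: (l ++ m) : List V), ⟨?_, ?_, ?_⟩, ?_⟩
  · have := List.length_pos_iff.2 hl
    simp; omega
  · rw [Cycle.nodup_coe_iff, ← List.cons_append]
    refine List.Nodup.append hnd.of_append_left hLnd.of_append_left fun x hx hxm ↦ ?_
    rcases List.mem_cons.1 hx with rfl | hx
    · exact List.disjoint_of_nodup_append hLnd hxm (by simp)
    · exact (AvoidReach.notMem (hreach x (by simp [hxm])) hql) hx
  · rw [Cycle.chain_coe_cons, List.append_assoc, ← List.cons_append]
    refine List.IsChain.append hch.left_of_append (hLch.imp fun _ _ h ↦ h.1) fun x hx y hy ↦ ?_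
    rw [hhd] at hy
    exact (List.isChain_append.1 hch).2.2 x hx y (by simpa using hy)
  · simp

theorem exists_path_to_bigClass {V : Type*} [Finite V] {r : V → V → Prop} {q : V} {l : List V}
    (hn : 2 ≤ Nat.card V) (hch : (l ++ [q]).IsChain r)
    (hnd : (l ++ [q]).Nodup) (hq : q ∈ bigClass r {x | x ∈ l})
    (hne : (bigClass r {x | x ∈ l ++ [q]}).Nonempty) :
    ∃ w : List V, (l ++ [q] ++ w).IsChain r ∧ (l ++ [q] ++ w).Nodup ∧
      ∃ b ∈ w, b ∈ bigClass r {x | x ∈ l ++ [q]} := by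
  obtain ⟨b, hb⟩ := hne
  have hbl : b ∈ bigClass r {x | x ∈ l} := bigClass_anti (fun x hx ↦ by
    simp only [Set.mem_ofPred_eq] at hx ⊢; simp [hx]) hb
  have hbq : b ≠ q := fun h ↦ notMem_of_mem_bigClass hn hb (by simp [h])
  obtain ⟨L, hLnd, hLch, hhd, hlast, hreach⟩ :=
    (mem_strongClass_of_mem_bigClass hq hbl).1.exists_nodup_isChain
  obtain ⟨m, rfl⟩ := List.head?_eq_some_iff.1 hhd
  refine ⟨m, ?_, ?_, b, ?_, hb⟩
  · rw [List.append_assoc]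
    refine List.IsChain.append hch.left_of_append (hLch.imp fun _ _ h ↦ h.1) fun x hx y hy ↦ ?_
    exact (List.isChain_append.1 hch).2.2 x hx y (by simpa using hy)
  · rw [List.append_assoc]
    refine List.Nodup.append hnd.of_append_left hLnd fun x hx hxm ↦ ?_
    exact AvoidReach.notMem (hreach x hxm) (notMem_of_mem_bigClass hn hq) hx
  · have := List.mem_of_getLast? hlast
    simpa [hbq] using this

/-- A window `l` of at most `t` vertices slides along a path whose remainder `w` visits the large
component left by `l`. The outer induction is on the size of that component, the inner one on `w`.
-/
theorem exists_cycle_of_path_to_bigClass {V : Type*} [Finite V] {D : Digraph V} {t : ℕ} (ht : 2 ≤ t)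
    (hn : 2 ≤ Nat.card V)
    (h : ∀ l : List V, l.IsChain D.Adj → l.Nodup → l.length ≤ t →
      (bigClass D.Adj {x | x ∈ l}).Nonempty) (N : ℕ) :
    ∀ (w l : List V) (b : V), l ≠ [] → l.length ≤ t →
    (l ++ w).IsChain D.Adj → (l ++ w).Nodup → b ∈ w → b ∈ bigClass D.Adj {x | x ∈ l} →
    (bigClass D.Adj {x | x ∈ l}).ncard ≤ N →
    ∃ C : Cycle V, D.IsDirectedCycle C ∧ t ≤ C.length := by
  induction N with
  | zero =>
    intro w l b _ _ _ _ _ hb hN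
    have := (Set.ncard_pos (Set.toFinite _)).2 ⟨b, hb⟩
    omega
  | succ N ihN =>
    intro w
    induction w with
    | nil => intro l b _ _ _ _ hb; simp at hb
    | cons q w ihw =>
      have key : ∀ (l : List V) (b : V), l.length < t →
          (l ++ q :: w).IsChain D.Adj → (l ++ q :: w).Nodup → b ∈ q :: w →
          b ∈ bigClass D.Adj {x | x ∈ l} → (bigClass D.Adj {x | x ∈ l}).ncard ≤ N + 1 →
          ∃ C : Cycle V, D.IsDirectedCycle C ∧ t ≤ C.length := by
        intro l b hlt hch hnd hbw hb hN
        rw [List.append_cons] at hch hnd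
        have hlen : (l ++ [q]).length ≤ t := by simp; omega
        have hsub : {x | x ∈ l} ⊆ {x | x ∈ l ++ [q]} := fun x hx ↦ by
          simp only [Set.mem_ofPred_eq] at hx ⊢; simp [hx]
        by_cases hq : q ∈ bigClass D.Adj {x | x ∈ l}
        · obtain ⟨w', hch', hnd', b', hb'w, hb'⟩ := exists_path_to_bigClass hn
            hch.left_of_append hnd.of_append_left hq
            (h _ hch.left_of_append hnd.of_append_left hlen)
          refine ihN w' (l ++ [q]) b' (by simp) hlen hch' hnd' hb'w hb' ?_
          have : bigClass D.Adj {x | x ∈ l ++ [q]} ⊂ bigClass D.Adj {x | x ∈ l} :=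
            ⟨bigClass_anti hsub, fun hh ↦ notMem_of_mem_bigClass hn (hh hq) (by simp)⟩
          have := Set.ncard_lt_ncard this
          omega
        · have heq : bigClass D.Adj {x | x ∈ l} = bigClass D.Adj {x | x ∈ l ++ [q]} := by
            refine bigClass_eq_of_disjoint hsub fun y hy hyl ↦ ?_
            rcases List.mem_append.1 hyl with hyl | hyl
            · exact notMem_of_mem_bigClass hn hy hyl
            · rw [List.mem_singleton] at hyl
              exact hq (hyl ▸ hy)
          rcases List.mem_cons.1 hbw with rfl | hbw
          · exact absurd hb hq
          · exact ihw (l ++ [q]) b (by simp) hlen hch hnd hbw (heq ▸ hb) (heq ▸ hN)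
      intro l b hl hlt hch hnd hbw hb hN
      rcases hlt.lt_or_eq with hlt | hlt
      · exact key l b hlt hch hnd hbw hb hN
      · obtain _ | ⟨p, l⟩ := l
        · exact absurd rfl hl
        have hlen : l.length + 1 = t := by simpa using hlt
        have hl' : l ≠ [] := by rintro rfl; simp at hlen; omega
        have hsub : {x | x ∈ l} ⊆ {x | x ∈ p :: l} := fun x hx ↦ List.mem_cons_of_mem _ hx
        -- The window is full. If its first vertex `p` lies in the component left by the others, `b`
        -- returns to `p` and a cycle closes; otherwise `p` can be dropped without changing the
        -- component.
        by_cases hp : p ∈ bigClass D.Adj {x | x ∈ l}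
        · obtain ⟨C, hC, hCl⟩ := exists_cycle_of_close hl' hch hnd hbw
            (mem_strongClass_of_mem_bigClass (bigClass_anti hsub hb) hp).1
          exact ⟨C, hC, hlen ▸ hCl⟩
        · have heq : bigClass D.Adj {x | x ∈ l} = bigClass D.Adj {x | x ∈ p :: l} := by
            refine bigClass_eq_of_disjoint hsub fun y hy hyl ↦ ?_
            rcases List.mem_cons.1 hyl with hyl | hyl
            · exact hp (hyl ▸ hy)
            · exact notMem_of_mem_bigClass hn hy hyl
          exact key l b (by omega) hch.tail hnd.of_cons hbw (heq ▸ hb) (heq ▸ hN)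

/-- If no path on at most `t` vertices destroys all strong components containing more than half of
the vertices, there is a directed cycle of length at least `t`. -/
theorem exists_cycle_of_bigClass_nonempty {V : Type*} [Finite V] {D : Digraph V} {t : ℕ}
    (ht : 2 ≤ t) (hn : 2 ≤ Nat.card V)
    (h : ∀ l : List V, l.IsChain D.Adj → l.Nodup → l.length ≤ t →
      (bigClass D.Adj {x | x ∈ l}).Nonempty) :
    ∃ C : Cycle V, D.IsDirectedCycle C ∧ t ≤ C.length := by
  obtain ⟨q, hq⟩ := h [] (by simp) (by simp) (by simp)
  obtain ⟨w, hch, hnd, b, hbw, hb⟩ := exists_path_to_bigClass (l := []) (q := q) hn (by simp)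
    (by simp) hq (h _ (by simp) (by simp) (by simp; omega))
  exact exists_cycle_of_path_to_bigClass ht hn h _ w ([] ++ [q]) b (by simp) (by simp; omega) hch hnd hbw hb
    le_rfl

/-! ### Cuts and balls in vertex transitive graphs -/

namespace SimpleGraph

variable {V : Type*} {G : SimpleGraph V}

theorem Connected.mem_of_forall_adj (hG : G.Connected) {S : Set V} {a : V} (ha : a ∈ S)
    (hS : ∀ a ∈ S, ∀ b, G.Adj a b → b ∈ S) (b : V) : b ∈ S := by
  obtain ⟨p⟩ := hG.preconnected a b
  induction p with
  | nil => exact ha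
  | cons h _ ih => exact ih (hS _ ha _ h)

theorem Connected.dist_iso (hG : G.Connected) (φ : G ≃g G) (u v : V) :
    G.dist (φ u) (φ v) = G.dist u v := by
  have key : ∀ (ψ : G ≃g G) (u v : V), G.dist (ψ u) (ψ v) ≤ G.dist u v := by
    intro ψ u v
    obtain ⟨p, hp⟩ := hG.exists_walk_length_eq_dist u v
    have := dist_le (p.map ψ.toHom)
    rwa [Walk.length_map, hp] at this
  refine le_antisymm (key φ u v) ?_
  simpa using key φ.symm (φ u) (φ v)

theorem Connected.dist_le_succ (hG : G.Connected) {u v w : V} (h : G.Adj v w) :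
    G.dist u w ≤ G.dist u v + 1 := by
  have := hG.dist_triangle (u := u) (v := v) (w := w)
  rwa [dist_eq_one_iff_adj.2 h] at this

/-- All edges leaving `S` have both ends in the ball of radius `r` about `x`. -/
def CutNear (G : SimpleGraph V) (S : Set V) (x : V) (r : ℕ) : Prop :=
  ∀ a ∈ S, ∀ b ∉ S, G.Adj a b → G.dist x a ≤ r ∧ G.dist x b ≤ r

theorem CutNear.compl {S : Set V} {x : V} {r : ℕ} (h : G.CutNear S x r) : G.CutNear Sᶜ x r :=
  fun _ ha _ hb hab ↦ (h _ (not_not.1 hb) _ ha hab.symm).symm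

/-- A walk of length at most `r` from `y` that left `S` would use a cut edge within `r` of both `x`
and `y`. -/
theorem CutNear.ball_subset {S : Set V} {x y z : V} {r : ℕ} (h : G.CutNear S x r)
    (hG : G.Connected) (hy : y ∈ S) (hxy : 2 * r < G.dist x y) (hz : G.dist y z ≤ r) : z ∈ S := by
  have key : ∀ (u z : V) (p : G.Walk u z), u ∈ S → G.dist y u + p.length ≤ r → z ∈ S := by
    intro u z p
    induction p with
    | nil => exact fun hu _ ↦ hu
    | @cons u v w huv p ih =>
      intro hu hl
      rw [Walk.length_cons] at hl
      have h1 := hG.dist_le_succ (u := y) huv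
      refine ih ?_ (by omega)
      by_contra hv
      have h2 := (h u hu v hv huv).1
      have h3 := hG.dist_triangle (u := x) (v := u) (w := y)
      rw [dist_comm (u := u)] at h3
      omega
  obtain ⟨p, hp⟩ := hG.exists_walk_length_eq_dist y z
  exact key y z p hy (by rw [dist_self, hp]; omega)

/-- In a finite connected vertex transitive graph, the edges of a cut with both sides deep are not
contained in a ball. -/
theorem CutNear.forall_dist_le [Finite V] (hG : G.Connected)
    (htr : ∀ u v : V, ∃ φ : G ≃g G, φ u = v) {S : Set V} {x : V} {r : ℕ} (h : G.CutNear S x r) :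
    (∀ y ∈ S, G.dist x y ≤ 2 * r) ∨ ∀ y ∉ S, G.dist x y ≤ 2 * r := by
  induction hN : S.ncard using Nat.strong_induction_on generalizing S x with
  | _ N ih =>
  by_contra! hcon
  obtain ⟨⟨y, hyS, hy⟩, ⟨z, hzS, hz⟩⟩ := hcon
  -- Move the cut by an automorphism taking `x` to the deep vertex `y` of `S`, and let `T` be the
  -- side missing `x`. It will be a smaller counterexample.
  obtain ⟨T, hT, hxT, ⟨u, huT, hu⟩, ⟨v, hvT, hv⟩⟩ : ∃ T : Set V, G.CutNear T y r ∧ x ∉ T ∧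
      (∃ u ∈ T, 2 * r < G.dist y u) ∧ ∃ v ∉ T, 2 * r < G.dist y v := by
    obtain ⟨φ, hφ⟩ := htr x y
    have h1 : G.CutNear (φ.symm ⁻¹' S) y r := by
      intro a ha b hb hab
      have := h _ ha _ hb (φ.symm.map_adj_iff.2 hab)
      rw [← hG.dist_iso φ x (φ.symm a), ← hG.dist_iso φ x (φ.symm b), hφ] at this
      simpa using this
    have h2 : φ y ∈ φ.symm ⁻¹' S := by simpa using hyS
    have h3 : φ z ∉ φ.symm ⁻¹' S := by simpa using hzS
    have h4 : 2 * r < G.dist y (φ y) := by rw [← hφ, hG.dist_iso, hφ]; exact hy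
    have h5 : 2 * r < G.dist y (φ z) := by rw [← hφ, hG.dist_iso]; exact hz
    by_cases hx : x ∈ φ.symm ⁻¹' S
    · exact ⟨_, h1.compl, not_not.2 hx, ⟨_, h3, h5⟩, ⟨_, not_not.2 h2, h4⟩⟩
    · exact ⟨_, h1, hx, ⟨_, h2, h4⟩, ⟨_, h3, h5⟩⟩
  have hyx : 2 * r < G.dist y x := by rwa [dist_comm]
  have hTS : T ⊆ S := by
    by_contra hTS
    obtain ⟨w, hwT, hwS⟩ := Set.not_subset.1 hTS
    -- No edge leaves `T \ S`: the cut of `T` lies in a ball about `y` inside `S`, and the cut of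
    -- `S` in a ball about `x` missing `T`.
    refine (hG.mem_of_forall_adj (S := T \ S) ⟨hwT, hwS⟩ (fun a ha b hab ↦ ⟨?_, ?_⟩) y).2 hyS
    · by_contra hb
      exact ha.2 (h.ball_subset hG hyS hy (hT a ha.1 b hb hab).1)
    · intro hb
      exact (hT.compl.ball_subset hG hxT hyx (h b hb a ha.2 hab.symm).2) ha.1
  have hne : T ≠ S := by
    rintro rfl
    refine hvT (hG.mem_of_forall_adj huT (fun a ha b hab ↦ ?_) v)
    by_contra hb
    have h1 := (hT a ha b hb hab).1
    have h2 := (h a ha b hb hab).1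
    have h3 := hG.dist_triangle (u := x) (v := a) (w := y)
    rw [dist_comm (u := a)] at h3
    omega
  rcases ih _ (hN ▸ Set.ncard_lt_ncard (hTS.ssubset_of_ne hne)) hT rfl with h1 | h1
  · exact absurd (h1 u huT) (by omega)
  · exact absurd (h1 v hvT) (by omega)

theorem Walk.dist_getVert (hG : G.Connected) {u v : V} (p : G.Walk u v)
    (hp : p.length = G.dist u v) {k : ℕ} (hk : k ≤ p.length) : G.dist u (p.getVert k) = k := by
  have h1 := dist_le (p.take k)
  have h2 := dist_le (p.drop k)
  rw [Walk.take_length] at h1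
  rw [Walk.drop_length] at h2
  have h3 := hG.dist_triangle (u := u) (v := p.getVert k) (w := v)
  omega

/-- If a ball of radius `R` contains a quarter of the vertices, then the diameter is less than
`4 * (2 * R + 1)`. -/
theorem Connected.dist_lt_of_card_ball [Fintype V] (hG : G.Connected)
    (htr : ∀ u v : V, ∃ φ : G ≃g G, φ u = v) {x : V} {R : ℕ}
    (hR : Fintype.card V ≤ 4 * (Finset.univ.filter fun z ↦ G.dist x z ≤ R).card) (u v : V) :
    G.dist u v < 4 * (2 * R + 1) := by
  classical
  by_contra! hlt
  obtain ⟨p, hp⟩ := hG.exists_walk_length_eq_dist u v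
  -- Five balls centred at spacing `2 * R + 1` along a geodesic are disjoint, yet each has at least
  -- a quarter of the vertices.
  let B : ℕ → Finset V := fun i ↦
    Finset.univ.filter fun z ↦ G.dist (p.getVert (i * (2 * R + 1))) z ≤ R
  have hd : ∀ i ∈ Finset.range 5, G.dist u (p.getVert (i * (2 * R + 1))) = i * (2 * R + 1) := by
    intro i hi
    refine p.dist_getVert hG hp ?_
    have : i ≤ 4 := by have := Finset.mem_range.1 hi; omega
    have := Nat.mul_le_mul_right (2 * R + 1) this
    omega
  have hB : ∀ i, (B i).card = (Finset.univ.filter fun z ↦ G.dist x z ≤ R).card := by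
    intro i
    obtain ⟨φ, hφ⟩ := htr x (p.getVert (i * (2 * R + 1)))
    refine (Finset.card_bij (fun z _ ↦ φ z) ?_ (fun _ _ _ _ h ↦ φ.injective h) ?_).symm
    · intro z hz
      simpa [B, ← hφ, hG.dist_iso] using hz
    · intro z hz
      refine ⟨φ.symm z, ?_, by simp⟩
      have : G.dist (φ x) (φ (φ.symm z)) ≤ R := by simpa [B, ← hφ] using hz
      rw [hG.dist_iso] at this
      simpa using this
  have hlt' : ∀ i ∈ Finset.range 5, ∀ j ∈ Finset.range 5, i < j → Disjoint (B i) (B j) := by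
    intro i hi j hj hij
    refine Finset.disjoint_left.2 fun z hzi hzj ↦ ?_
    have h1 : G.dist (p.getVert (i * (2 * R + 1))) z ≤ R := by simpa [B] using hzi
    have h2 : G.dist (p.getVert (j * (2 * R + 1))) z ≤ R := by simpa [B] using hzj
    have h3 := hd i hi
    have h4 := hd j hj
    have h5 := hG.dist_triangle (u := u) (v := p.getVert (i * (2 * R + 1))) (w := z)
    have h6 := hG.dist_triangle (u := u) (v := z) (w := p.getVert (j * (2 * R + 1)))
    rw [dist_comm (u := z)] at h6
    have h7 := Nat.mul_le_mul_right (2 * R + 1) (Nat.succ_le_of_lt hij)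
    rw [Nat.succ_mul] at h7
    omega
  have hsum := Finset.card_biUnion (s := Finset.range 5) (t := B) fun i hi j hj hij ↦ by
    rcases hij.lt_or_gt with h | h
    · exact hlt' i hi j hj h
    · exact (hlt' j hj i hi h).symm
  have hle := Finset.card_le_univ ((Finset.range 5).biUnion B)
  have hpos : 0 < Fintype.card V := Fintype.card_pos_iff.2 ⟨x⟩
  rw [hsum, Finset.sum_congr rfl fun i _ ↦ hB i, Finset.sum_const, Finset.card_range,
    smul_eq_mul] at hle
  omega

end SimpleGraph

/-! ### Directed distances -/

/-- `ReachLE r k u v` says that `v` can be reached from `u` by at most `k` steps along `r`. -/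
def ReachLE {V : Type*} (r : V → V → Prop) : ℕ → V → V → Prop
  | 0, u, v => u = v
  | k + 1, u, v => ∃ w, (u = w ∨ r u w) ∧ ReachLE r k w v

namespace ReachLE

variable {V : Type*} {r : V → V → Prop}

theorem refl (k : ℕ) (u : V) : ReachLE r k u u := by
  induction k with
  | zero => rfl
  | succ k ih => exact ⟨u, .inl rfl, ih⟩

theorem trans {j k : ℕ} {u v w : V} (h : ReachLE r j u v) (h' : ReachLE r k v w) :
    ReachLE r (j + k) u w := by
  induction j generalizing u with
  | zero =>
    obtain rfl : u = v := h
    simpa using h'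
  | succ j ih =>
    obtain ⟨x, hx, hxv⟩ := h
    rw [Nat.succ_add]
    exact ⟨x, hx, ih hxv⟩

theorem mono {j k : ℕ} {u v : V} (hjk : j ≤ k) (h : ReachLE r j u v) : ReachLE r k u v := by
  obtain ⟨i, rfl⟩ := Nat.exists_eq_add_of_le hjk
  exact h.trans (refl i v)

theorem of_isChain {a b : V} {L : List V} (hL : (a :: L).IsChain r) (hb : b ∈ a :: L) :
    ReachLE r L.length a b := by
  induction L generalizing a with
  | nil => exact (List.mem_singleton.1 hb).symm
  | cons c L ih =>
    rw [List.isChain_cons_cons] at hL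
    rcases List.mem_cons.1 hb with rfl | hb
    · exact refl _ _
    · exact ⟨c, .inr hL.1, ih hL.2 hb⟩

theorem dist_le {D : Digraph V} (hD : D.IsConnected) {k : ℕ} {u v : V} (h : ReachLE D.Adj k u v) :
    D.toSimpleGraphInclusive.dist u v ≤ k := by
  induction k generalizing u with
  | zero =>
    obtain rfl : u = v := h
    simp
  | succ k ih =>
    obtain ⟨w, hw, hwv⟩ := h
    have h1 := ih hwv
    rcases hw with rfl | hw
    · omega
    · have h2 := SimpleGraph.Connected.dist_triangle hD (u := u) (v := w) (w := v)
      by_cases huw : u = w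
      · subst huw; omega
      · have : D.toSimpleGraphInclusive.Adj u w := (SimpleGraph.fromRel_adj _ _ _).2 ⟨huw, .inl hw⟩
        rw [SimpleGraph.dist_eq_one_iff_adj.2 this] at h2
        omega

/-- If undirected edges can be traversed in both directions in at most `t` steps, then directed
distances are at most `t` times undirected distances. -/
theorem of_walk {D : Digraph V} {t : ℕ}
    (h : ∀ u v, D.toSimpleGraphInclusive.Adj u v → ReachLE D.Adj t u v) {u v : V}
    (p : D.toSimpleGraphInclusive.Walk u v) : ReachLE D.Adj (p.length * t) u v := by
  induction p with
  | nil => exact refl _ _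
  | cons huv p ih =>
    rw [SimpleGraph.Walk.length_cons, Nat.succ_mul, add_comm]
    exact (h _ _ huv).trans ih

end ReachLE

/-! ### Vertex transitive digraphs: short returns, isoperimetry and the cubic bound -/

namespace Digraph

variable {V : Type*} {D : Digraph V}

theorem IsVertexTransitive.toSimpleGraphInclusive (hD : D.IsVertexTransitive) (u v : V) :
    ∃ φ : D.toSimpleGraphInclusive ≃g D.toSimpleGraphInclusive, φ u = v := by
  obtain ⟨φ, hφ⟩ := hD u v
  refine ⟨⟨φ.toEquiv, fun {a b} ↦ ?_⟩, hφ⟩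
  simp only [Digraph.toSimpleGraphInclusive, SimpleGraph.fromRel_adj]
  exact and_congr φ.injective.ne_iff (or_congr φ.map_rel_iff φ.map_rel_iff)

/-- The set reachable from `v` lies in the one reachable from `u`, and transitivity makes their
sizes equal, so they coincide. -/
theorem IsVertexTransitive.reflTransGen_symm [Finite V] (hD : D.IsVertexTransitive) {u v : V}
    (huv : D.Adj u v) : ReflTransGen D.Adj v u := by
  obtain ⟨φ, hφ⟩ := hD u v
  have h1 : {w | ReflTransGen D.Adj v w} ⊆ {w | ReflTransGen D.Adj u w} :=
    fun w hw ↦ ReflTransGen.head huv hw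
  have h2 : φ '' {w | ReflTransGen D.Adj u w} ⊆ {w | ReflTransGen D.Adj v w} := by
    rintro _ ⟨w, hw, rfl⟩
    rw [← hφ]
    exact ReflTransGen.lift φ (fun a b h ↦ φ.map_rel_iff.2 h) _ _ hw
  have h3 := Set.ncard_le_ncard h2
  rw [Set.ncard_image_of_injective _ φ.injective] at h3
  have h4 := Set.eq_of_subset_of_ncard_le h1 h3
  have : u ∈ {w | ReflTransGen D.Adj u w} := ReflTransGen.refl
  rwa [← h4] at this

/-- Every arc of a finite vertex transitive digraph that is not a loop lies on a directed cycle. -/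
theorem IsVertexTransitive.exists_isDirectedCycle_of_adj [Finite V] (hD : D.IsVertexTransitive)
    {u v : V} (huv : D.Adj u v) (hne : u ≠ v) :
    ∃ L : List V, (v :: L).IsChain D.Adj ∧ u ∈ v :: L ∧ D.IsDirectedCycle (v :: L : List V) := by
  obtain ⟨L, hnd, hch, hhd, hlast, -⟩ := (hD.reflTransGen_symm huv).exists_nodup_isChain
  obtain ⟨L, rfl⟩ := List.head?_eq_some_iff.1 hhd
  have hu := List.mem_of_getLast? hlast
  refine ⟨L, hch, hu, ?_, hnd, ?_⟩
  · cases L with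
    | nil => simp [hne] at hu
    | cons => simp
  · rw [Cycle.chain_coe_cons, ← List.cons_append]
    refine hch.append (by simp) fun x hx y hy ↦ ?_
    rw [hlast] at hx
    simp only [Option.mem_def, Option.some.injEq, List.head?_cons] at hx hy
    exact hx ▸ hy ▸ huv

/-- In a vertex transitive digraph without directed cycles of length at least `t`, the tail of an
arc can be reached from its head along a path on less than `t` vertices. -/
theorem IsVertexTransitive.exists_return [Finite V] (hD : D.IsVertexTransitive) {t : ℕ}
    (ht : ∀ C : Cycle V, D.IsDirectedCycle C → C.length < t) {u v : V} (huv : D.Adj u v)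
    (hne : u ≠ v) : ∃ L : List V, (v :: L).IsChain D.Adj ∧ u ∈ v :: L ∧ L.length + 1 < t := by
  obtain ⟨L, hch, hu, hC⟩ := hD.exists_isDirectedCycle_of_adj huv hne
  exact ⟨L, hch, hu, by simpa using ht _ hC⟩

theorem IsVertexTransitive.exists_isDirectedCycle [Finite V] [Nontrivial V]
    (hD : D.IsVertexTransitive) (hc : D.IsConnected) : ∃ C : Cycle V, D.IsDirectedCycle C := by
  obtain ⟨u, v, huv⟩ := SimpleGraph.ne_bot_iff_exists_adj.1
    (fun h : D.toSimpleGraphInclusive = ⊥ ↦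
      SimpleGraph.not_preconnected_bot (V := V) (h ▸ hc.preconnected))
  obtain ⟨hne, h | h⟩ := (SimpleGraph.fromRel_adj _ _ _).1 huv
  · obtain ⟨L, -, -, hC⟩ := hD.exists_isDirectedCycle_of_adj h hne
    exact ⟨_, hC⟩
  · obtain ⟨L, -, -, hC⟩ := hD.exists_isDirectedCycle_of_adj h hne.symm
    exact ⟨_, hC⟩

/-- Vertex isoperimetry in vertex transitive digraphs of diameter at most `K`. -/
theorem IsVertexTransitive.card_mul_card_compl_le [Fintype V] [DecidableEq V]
    (hD : D.IsVertexTransitive)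
    {A Z : Finset V} (hA : ∀ a ∈ A, ∀ b, D.Adj a b → b ∈ A ∨ b ∈ Z) {K : ℕ}
    (hK : ∀ u v, ReachLE D.Adj K u v) : A.card * Aᶜ.card ≤ Fintype.card V * (K * Z.card) := by
  classical
  rcases isEmpty_or_nonempty V with hV | ⟨⟨o⟩⟩
  · simp [Finset.eq_empty_of_isEmpty A]
  have : Finite (D.Adj ≃r D.Adj) := DFunLike.finite _
  have := Fintype.ofFinite (D.Adj ≃r D.Adj)
  -- By transitivity `N a b` is a positive constant, so a random automorphism sends each vertex to a
  -- uniform one.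
  let N : V → V → ℕ := fun a b ↦ (Finset.univ.filter fun g : D.Adj ≃r D.Adj ↦ g a = b).card
  have hNle : ∀ a b a' b', N a b ≤ N a' b' := by
    intro a b a' b'
    obtain ⟨h₁, hh₁⟩ := hD a' a
    obtain ⟨h₂, hh₂⟩ := hD b b'
    refine Finset.card_le_card_of_injOn (fun g ↦ (h₁.trans g).trans h₂) ?_ ?_
    · intro g hg
      have : g a = b := by simpa using hg
      simp [hh₁, this, hh₂]
    · intro g _ g' _ h
      ext x
      have := DFunLike.congr_fun h (h₁.symm x)
      simpa using this
  have hNeq : ∀ a b, N a b = N o o := fun a b ↦ le_antisymm (hNle _ _ _ _) (hNle _ _ _ _)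
  have hpos : 0 < N o o := Finset.card_pos.2 ⟨RelIso.refl _, by simp⟩
  have hcount : ∀ (w : V) (T : Finset V),
      (Finset.univ.filter fun g : D.Adj ≃r D.Adj ↦ g w ∈ T).card = T.card * N o o := by
    intro w T
    rw [Finset.card_eq_sum_card_fiberwise (f := fun g : D.Adj ≃r D.Adj ↦ g w) (t := T)
      (fun g hg ↦ by simpa using hg)]
    rw [Finset.sum_congr rfl (g := fun _ ↦ N o o), Finset.sum_const, smul_eq_mul]
    intro b hb
    rw [← hNeq w b, Finset.filter_filter]
    congr 1
    ext g
    simp only [Finset.mem_filter, Finset.mem_univ, true_and]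
    exact ⟨fun h ↦ h.2, fun h ↦ ⟨h ▸ hb, h⟩⟩
  -- The image of a walk from `u` to `v` that starts in `A` and ends outside must enter `Z`; a union
  -- bound over its steps counts such automorphisms.
  have hcross : ∀ (k : ℕ) (u v : V), ReachLE D.Adj k u v →
      (Finset.univ.filter fun g : D.Adj ≃r D.Adj ↦ g u ∈ A ∧ g v ∉ A).card
        ≤ k * (Z.card * N o o) := by
    intro k
    induction k with
    | zero =>
      rintro u v (rfl : u = v)
      simp
    | succ k ih =>
      rintro u v ⟨w, huw, hwv⟩
      rw [Nat.succ_mul]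
      nth_rw 2 [← hcount w Z]
      refine le_trans (Finset.card_le_card fun g hg ↦ ?_)
        ((Finset.card_union_le (Finset.univ.filter fun g : D.Adj ≃r D.Adj ↦ g w ∈ A ∧ g v ∉ A)
          (Finset.univ.filter fun g : D.Adj ≃r D.Adj ↦ g w ∈ Z)).trans
          (Nat.add_le_add_right (ih w v hwv) _))
      simp only [Finset.mem_filter, Finset.mem_univ, true_and, Finset.mem_union] at hg ⊢
      rcases huw with rfl | huw
      · exact .inl hg
      · exact (hA _ hg.1 _ (g.map_rel_iff.2 huw)).imp_left fun h ↦ ⟨h, hg.2⟩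
  have hdouble := Finset.sum_card_bipartiteAbove_eq_sum_card_bipartiteBelow
    (s := (Finset.univ : Finset V))
    (t := Finset.univ.filter fun g : D.Adj ≃r D.Adj ↦ g o ∈ A) (fun v g ↦ g v ∉ A)
  have hleft : ∑ v : V, (Finset.bipartiteAbove (fun (v : V) (g : D.Adj ≃r D.Adj) ↦ g v ∉ A)
      (Finset.univ.filter fun g : D.Adj ≃r D.Adj ↦ g o ∈ A) v).card
      ≤ Fintype.card V * (K * (Z.card * N o o)) := by
    refine (Finset.sum_le_card_nsmul _ _ (K * (Z.card * N o o)) fun v _ ↦ ?_).trans_eq (by simp)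
    rw [Finset.bipartiteAbove, Finset.filter_filter]
    exact hcross K o v (hK o v)
  have hright : ∀ g : D.Adj ≃r D.Adj,
      (Finset.bipartiteBelow (fun (v : V) (g : D.Adj ≃r D.Adj) ↦ g v ∉ A)
        (Finset.univ : Finset V) g).card = Aᶜ.card := by
    intro g
    refine Finset.card_bij (fun v _ ↦ g v) ?_ (fun _ _ _ _ h ↦ g.injective h) ?_
    · intro v hv
      simpa [Finset.bipartiteBelow] using hv
    · intro v hv
      exact ⟨g.symm v, by simpa [Finset.bipartiteBelow] using hv, by simp⟩
  rw [hdouble, Finset.sum_congr rfl fun g _ ↦ hright g, Finset.sum_const, hcount o A,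
    smul_eq_mul] at hleft
  refine Nat.le_of_mul_le_mul_right (c := N o o) ?_ hpos
  linarith

/-- A finite connected vertex transitive digraph without directed cycles of length at least `t` has
at most `832 * t ^ 3` vertices. -/
theorem IsVertexTransitive.card_le [Fintype V] (hD : D.IsVertexTransitive) (hc : D.IsConnected)
    (hn : 2 ≤ Fintype.card V) {t : ℕ} (ht : 2 ≤ t)
    (hlt : ∀ C : Cycle V, D.IsDirectedCycle C → C.length < t) :
    Fintype.card V ≤ 832 * t ^ 3 := by
  classical
  by_contra! hbig
  have ht3 : t ≤ t ^ 3 := Nat.le_self_pow (by norm_num) t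
  have hcard : Nat.card V = Fintype.card V := Nat.card_eq_fintype_card
  set G := D.toSimpleGraphInclusive with hGdef
  have hG : G.Connected := hc
  have htr := hD.toSimpleGraphInclusive
  obtain ⟨l, hch, hlen, A, hAZ, hA, hA1, hA2⟩ : ∃ l : List V, l.IsChain D.Adj ∧ l.length ≤ t ∧
      ∃ A : Finset V, Disjoint A l.toFinset ∧
        (∀ a ∈ A, ∀ b, D.Adj a b → b ∈ A ∨ b ∈ l.toFinset) ∧
        Fintype.card V ≤ 4 * A.card ∧ Fintype.card V ≤ 4 * Aᶜ.card := by
    by_contra! hno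
    obtain ⟨C, hC, htC⟩ := exists_cycle_of_bigClass_nonempty (D := D) ht (by omega) (by
      intro l hch hnd hlen
      have hZ : ({x | x ∈ l} : Set V).ncard ≤ l.length := by
        rw [← List.coe_toFinset, Set.ncard_coe_finset]
        exact List.toFinset_card_le l
      refine bigClass_nonempty (by omega) (by omega) fun B hB hBc ↦ ?_
      by_contra! hcon
      refine absurd (hno l hch hlen B.toFinset ?_ ?_ ?_) (not_lt.2 ?_)
      · rw [← Finset.disjoint_coe]
        simpa using hB
      · simpa using hBc
      · rw [← Set.ncard_eq_toFinset_card', ← hcard]; exact hcon.1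
      · rw [← Set.toFinset_compl, ← Set.ncard_eq_toFinset_card', ← hcard]; exact hcon.2)
    exact absurd (hlt C hC) (by omega)
  have hstep : ∀ u v, G.Adj u v → ReachLE D.Adj t u v := by
    intro u v huv
    obtain ⟨hne, h | h⟩ := (SimpleGraph.fromRel_adj _ _ _).1 huv
    · exact ReachLE.mono (by omega : 1 ≤ t) ⟨v, .inr h, rfl⟩
    · obtain ⟨L, hL, hmem, hLt⟩ := hD.exists_return hlt h hne.symm
      exact (ReachLE.of_isChain hL hmem).mono (by omega)
  -- With `x` the start of `l`, a vertex of `l` is within `t - 1` of `x`, the end of a cut edge in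
  -- `A` within `t` of such a vertex, and the other end one further; `3 * t` is generous.
  obtain ⟨x, hcut⟩ : ∃ x, G.CutNear (A : Set V) x (3 * t) := by
    have hAne : A.Nonempty := Finset.card_pos.1 (by omega)
    have hmeet : ∀ a ∈ A, ∀ b ∉ A, G.Adj a b → ∃ z ∈ l, G.dist a z ≤ t := by
      intro a ha b hb hab
      obtain ⟨hne, h | h⟩ := (SimpleGraph.fromRel_adj _ _ _).1 hab
      · exact ⟨b, by simpa using (hA a ha b h).resolve_left hb,
          by rw [SimpleGraph.dist_eq_one_iff_adj.2 hab]; omega⟩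
      · obtain ⟨L, hL, hmem, hLt⟩ := hD.exists_return hlt h hne.symm
        by_contra! hfar
        have hall : ∀ x ∈ a :: L, x ∉ {x | x ∈ l} := fun x hx hxl ↦ by
          have : G.dist a x ≤ _ := (ReachLE.of_isChain hL hx).dist_le hc
          have := hfar x hxl
          omega
        -- For an arc from `b` into `A`, a return path from `a` to `b` missing `l` could not leave
        -- `A`.
        have hr := hL.avoidReach hall hmem
        refine hb ?_
        clear hmem hne hab h hb
        induction hr with
        | refl => exact ha
        | tail _ h ih => exact (hA _ ih _ h.1).resolve_right (by simpa using h.2.2)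
    obtain _ | ⟨x, l⟩ := l
    · exfalso
      obtain ⟨a, ha⟩ := hAne
      have h0 : ∀ b, b ∈ (A : Set V) := by
        refine hG.mem_of_forall_adj ha fun a ha b hab ↦ ?_
        by_contra hb
        obtain ⟨z, hz, -⟩ := hmeet a ha b hb hab
        simp at hz
      have : Aᶜ.card = 0 := by simpa [Finset.eq_univ_iff_forall] using h0
      omega
    · refine ⟨x, fun a ha b hb hab ↦ ?_⟩
      obtain ⟨z, hz, haz⟩ := hmeet a ha b hb hab
      have h1 := (ReachLE.of_isChain hch hz).dist_le hc
      have h2 := hG.dist_triangle (u := x) (v := z) (w := a)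
      rw [SimpleGraph.dist_comm (u := z)] at h2
      have h3 := hG.dist_le_succ (u := x) hab
      simp only [List.length_cons] at hlen
      change G.dist x z ≤ _ at h1
      omega
  have hball : Fintype.card V ≤
      4 * (Finset.univ.filter fun z ↦ G.dist x z ≤ 2 * (3 * t)).card := by
    rcases hcut.forall_dist_le hG htr with h | h
    · refine hA1.trans (Nat.mul_le_mul_left 4 (Finset.card_le_card fun z hz ↦ ?_))
      simpa using h z hz
    · refine hA2.trans (Nat.mul_le_mul_left 4 (Finset.card_le_card fun z hz ↦ ?_))
      simpa using h z (by simpa using hz)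
  -- `4 * (2 * (6 * t) + 1) ≤ 52 * t` bounds the undirected diameter, and each edge costs at most
  -- `t` directed steps.
  have hdiam : ∀ u v, ReachLE D.Adj (52 * t * t) u v := by
    intro u v
    have h1 := hG.dist_lt_of_card_ball htr hball u v
    obtain ⟨p, hp⟩ := hG.exists_walk_length_eq_dist u v
    exact (ReachLE.of_walk hstep p).mono (Nat.mul_le_mul_right t (by omega))
  have hiso := hD.card_mul_card_compl_le hA hdiam
  have hZ : l.toFinset.card ≤ t := (List.toFinset_card_le l).trans hlen
  have h1 : Fintype.card V * Fintype.card V ≤ Fintype.card V * (832 * t ^ 3) := by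
    calc Fintype.card V * Fintype.card V ≤ (4 * A.card) * (4 * Aᶜ.card) := Nat.mul_le_mul hA1 hA2
      _ = 16 * (A.card * Aᶜ.card) := by ring
      _ ≤ 16 * (Fintype.card V * (52 * t * t * t)) :=
        Nat.mul_le_mul_left 16 (hiso.trans (Nat.mul_le_mul_left _ (Nat.mul_le_mul_left _ hZ)))
      _ = Fintype.card V * (832 * t ^ 3) := by ring
  exact absurd (Nat.le_of_mul_le_mul_left h1 (by omega)) (not_le.2 hbig)

end Digraph

/-! ### Choice of the constant -/

theorem theorem1p2 :
    ∃ c : ℝ, 0 < c ∧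
      ∀ (V : Type*) [Fintype V] (D : Digraph V),
        2 ≤ Fintype.card V → D.IsConnected → D.IsVertexTransitive →
          ∃ C : Cycle V, D.IsDirectedCycle C ∧
            c * (Fintype.card V : ℝ) ^ (1 / 3 : ℝ) ≤ (C.length : ℝ) := by
  -- Rounding `s / 20` up to an integer that is at least 3 costs a factor of at most `3 / 2`, and
  -- `832 * (3 / 40) ^ 3 < 1`.
  refine ⟨1 / 20, by norm_num, fun V _ D hn hc hD ↦ ?_⟩
  by_contra! hcon
  set n := Fintype.card V
  set s : ℝ := (n : ℝ) ^ (1 / 3 : ℝ) with hs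
  have hs0 : 0 ≤ s := by positivity
  have hs3 : s ^ 3 = n := by
    rw [hs, ← Real.rpow_natCast, ← Real.rpow_mul (by positivity)]
    norm_num
  have hlt : ∀ C : Cycle V, D.IsDirectedCycle C → C.length < ⌈1 / 20 * s⌉₊ := fun C hC ↦
    Nat.lt_ceil.2 (hcon C hC)
  have ht := hD.card_le hc hn (t := max 2 ⌈1 / 20 * s⌉₊) (le_max_left _ _)
    fun C hC ↦ (hlt C hC).trans_le (le_max_right _ _)
  have := Fintype.one_lt_card_iff_nontrivial.1 hn
  -- Some cycle of length at least 2 exists, which forces the ceiling to be at least 3 and removes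
  -- the maximum.
  obtain ⟨C, hC⟩ := hD.exists_isDirectedCycle hc
  have h2 := hC.1
  have h3 := hlt C hC
  rw [max_eq_right (by omega)] at ht
  have h4 : (⌈1 / 20 * s⌉₊ : ℝ) < 1 / 20 * s + 1 := Nat.ceil_lt_add_one (by positivity)
  have h5 : (3 : ℝ) ≤ ⌈1 / 20 * s⌉₊ := by exact_mod_cast (by omega : 3 ≤ ⌈1 / 20 * s⌉₊)
  have h6 : (⌈1 / 20 * s⌉₊ : ℝ) ≤ 3 / 40 * s := by linarith
  have h7 : (n : ℝ) ≤ 832 * (⌈1 / 20 * s⌉₊ : ℝ) ^ 3 := by exact_mod_cast ht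
  have h8 : (⌈1 / 20 * s⌉₊ : ℝ) ^ 3 ≤ (3 / 40 * s) ^ 3 := by gcongr
  have h9 : (0 : ℝ) < n := by positivity
  rw [mul_pow, hs3] at h8
  linarith
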